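/- Let $\mathcal A,\mathcal B,\mathcal M,\mathcal R$ be finite-dimensional von Neumann algebras (that is, finite-dimensional unital $C^*$-algebras), equipped with faithful positive traces $\tau_{\mathcal A},\tau_{\mathcal B},\tau_{\mathcal M},\tau_{\mathcal R}$, not necessarily normalized. A density operator of $\mathcal M$ is an element $\rho\ge 0$ with $\tau_{\mathcal M}(\rho)=1$; write $D(\mathcal M)$ for the set of density operators and $H(\rho)=-\tau_{\mathcal M}(\rho\log\rho)$ for the entropy (with $0\log 0=0$), and similarly for the other algebras, each with its own trace. A quantum channel is a completely positive trace preserving linear map. The adjoint $\Phi^\dagger:\mathcal Y\to\mathcal X$ of a $*$-preserving linear map $\Phi:\mathcal X\to\mathcal Y$ is the linear map determined by $\tau_{\mathcal X}(\Phi^\dagger(y)x)=\tau_{\mathcal Y}(y\,\Phi(x))$ for all $x\in\mathcal X$, $y\in\mathcal Y$. Suppose that $\mathcal R\subset\mathcal A$ is a unital $*$-subalgebra (the trace $\tau_{\mathcal R}$ need not be the restriction of $\tau_{\mathcal A}$), and let $E_{\mathcal R}:\mathcal A\to\mathcal R$ be the adjoint of the inclusion. Let $\Phi_A:\mathcal M\to\mathcal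 A$ and $\Phi_B:\mathcal M\to\mathcal B$ be quantum channels. Then for every density operator $\rho\in D(\mathcal M)$, \[ H(\Phi_A(\rho))+H(\Phi_B(\rho))\;\ge\; H(\rho)+H(E_{\mathcal R}\circ\Phi_A(\rho))+\log\frac1c , \] where \[ c=\sup\{\tau_{\mathcal M}(\Phi_A^\dagger(a)\,\Phi_B^\dagger(b)) \;:\; a\in\mathcal A,\ a\ge 0,\ E_{\mathcal R}(a)=1,\ b\in D(\mathcal B)\}, \] the supremum of a nonempty bounded set of real numbers, which satisfies $0<c<\infty$. -/

import Mathlib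

/-!
A finite-dimensional von Neumann algebra is a unital C⋆-algebra that is finite-dimensional
over `ℂ` (equivalently, a ⋆-subalgebra of a matrix algebra).  The order is the C⋆-order.
-/

noncomputable section

namespace ChannelSSA

open scoped ComplexOrder

universe u v

/-- A faithful (positive, not necessarily normalized) trace on a C⋆-algebra. -/
structure FaithfulTrace (M : Type u) [CStarAlgebra M] [PartialOrder M] [StarOrderedRing M]
    extends M →ₗ[ℂ] ℂ where
  mul_comm' : ∀ x y : M, toFun (x * y) = toFun (y * x)
  nonneg' : ∀ x : M, 0 ≤ x → 0 ≤ toFun x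
  faithful' : ∀ x : M, 0 ≤ x → toFun x = 0 → x = 0

section

variable {M : Type u} [CStarAlgebra M] [PartialOrder M] [StarOrderedRing M]
variable {N : Type v} [CStarAlgebra N] [PartialOrder N] [StarOrderedRing N]

instance : CoeFun (FaithfulTrace M) (fun _ => M → ℂ) := ⟨fun τ => τ.toLinearMap⟩

/-- Density operators: positive elements of trace one. -/
def IsDensity (τ : FaithfulTrace M) (ρ : M) : Prop := 0 ≤ ρ ∧ τ ρ = 1

/-- The von Neumann entropy `H(ρ) = -τ(ρ log ρ)`, where `ρ log ρ` is the functional calculus of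
`t ↦ t log t` (with `0 log 0 = 0`). The trace of this self-adjoint element is real. -/
def entropy (τ : FaithfulTrace M) (ρ : M) : ℝ :=
  -(τ (cfc (fun t : ℝ => t * Real.log t) ρ)).re

/-- The map `x ↦ (y ↦ τ(x y))` from the algebra to its dual. -/
def FaithfulTrace.toDual (τ : FaithfulTrace M) : M →ₗ[ℂ] Module.Dual ℂ M :=
  (LinearMap.mul ℂ M).compr₂ τ.toLinearMap

theorem FaithfulTrace.toDual_apply (τ : FaithfulTrace M) (x y : M) :
    τ.toDual x y = τ (x * y) := rfl

theorem FaithfulTrace.toDual_injective (τ : FaithfulTrace M) :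
    Function.Injective τ.toDual := by
  rw [injective_iff_map_eq_zero]
  intro x hx
  have h : τ (x * star x) = 0 := by rw [← τ.toDual_apply, hx]; rfl
  exact CStarRing.mul_star_self_eq_zero_iff x |>.1 (τ.faithful' _ (mul_star_self_nonneg x) h)

/-- In finite dimensions the trace pairing identifies the algebra with its dual. -/
def FaithfulTrace.dualEquiv [FiniteDimensional ℂ M] (τ : FaithfulTrace M) :
    M ≃ₗ[ℂ] Module.Dual ℂ M :=
  LinearEquiv.ofInjectiveOfFinrankEq τ.toDual τ.toDual_injective
    Subspace.dual_finrank_eq.symm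

/-- The adjoint `Φ† : N → M` of a linear map `Φ : M → N` with respect to the traces, that is, the
unique linear map with `τ_M(Φ†(y) x) = τ_N(y Φ(x))`. For ⋆-preserving `Φ` (in particular for
positive maps and ⋆-homomorphisms) it is the adjoint for the inner products `τ(x⋆ y)`. -/
def traceAdjoint [FiniteDimensional ℂ M] (τM : FaithfulTrace M) (τN : FaithfulTrace N)
    (Φ : M →ₗ[ℂ] N) : N →ₗ[ℂ] M :=
  τM.dualEquiv.symm.toLinearMap ∘ₗ Φ.dualMap ∘ₗ τN.toDual

theorem traceAdjoint_spec [FiniteDimensional ℂ M] (τM : FaithfulTrace M) (τN : FaithfulTrace N)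
    (Φ : M →ₗ[ℂ] N) (y : N) (x : M) :
    τM (traceAdjoint τM τN Φ y * x) = τN (y * Φ x) := by
  have h : τM.dualEquiv (traceAdjoint τM τN Φ y) = Φ.dualMap (τN.toDual y) := by
    simp [traceAdjoint]
  exact congrArg (fun f : Module.Dual ℂ M => f x) h

theorem traceAdjoint_unique [FiniteDimensional ℂ M] (τM : FaithfulTrace M) (τN : FaithfulTrace N)
    (Φ : M →ₗ[ℂ] N) (Ψ : N →ₗ[ℂ] M) (h : ∀ y x, τM (Ψ y * x) = τN (y * Φ x)) :
    Ψ = traceAdjoint τM τN Φ := by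
  ext y
  apply τM.toDual_injective
  ext x
  rw [τM.toDual_apply, τM.toDual_apply, h, traceAdjoint_spec]

/-- A quantum channel: a completely positive trace preserving linear map. -/
structure QuantumChannel (τM : FaithfulTrace M) (τN : FaithfulTrace N)
    extends CompletelyPositiveMap M N where
  trace_preserving' : ∀ x : M, τN (toFun x) = τM x

instance (τM : FaithfulTrace M) (τN : FaithfulTrace N) :
    CoeFun (QuantumChannel τM τN) (fun _ => M → N) := ⟨fun Φ => Φ.toLinearMap⟩

/-- The adjoint `Φ†` of a quantum channel with respect to the traces. -/
def QuantumChannel.adjoint [FiniteDimensional ℂ M] {τM : FaithfulTrace M} {τN : FaithfulTrace N}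
    (Φ : QuantumChannel τM τN) : N →ₗ[ℂ] M :=
  traceAdjoint τM τN Φ.toLinearMap

/-- The map `E_R : A → R`, the adjoint of the embedding `ι : R → A` of a subalgebra. The trace of
`R` need not be the restriction of the trace of `A`. -/
def embeddingAdjoint {R : Type u} [CStarAlgebra R] [PartialOrder R] [StarOrderedRing R]
    [FiniteDimensional ℂ R] {A : Type v} [CStarAlgebra A] [PartialOrder A] [StarOrderedRing A]
    (τR : FaithfulTrace R) (τA : FaithfulTrace A) (ι : R →⋆ₐ[ℂ] A) : A →ₗ[ℂ] R :=
  traceAdjoint τR τA (ι : R →ₐ[ℂ] A).toLinearMap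

end

/-- The set of all `τ_M(Φ_A†(a) Φ_B†(b))` with `a ≥ 0`, `E_R(a) = 1` and `b` a density operator.
These traces of products of two positive elements are real. -/
def overlapSet {A B M R : Type*}
    [CStarAlgebra A] [PartialOrder A] [StarOrderedRing A]
    [CStarAlgebra B] [PartialOrder B] [StarOrderedRing B]
    [CStarAlgebra M] [PartialOrder M] [StarOrderedRing M] [FiniteDimensional ℂ M]
    [CStarAlgebra R] [PartialOrder R] [StarOrderedRing R] [FiniteDimensional ℂ R]
    {τA : FaithfulTrace A} {τB : FaithfulTrace B} {τM : FaithfulTrace M} (τR : FaithfulTrace R)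
    (ι : R →⋆ₐ[ℂ] A) (ΦA : QuantumChannel τM τA) (ΦB : QuantumChannel τM τB) : Set ℝ :=
  {t | ∃ a : A, ∃ b : B, 0 ≤ a ∧ embeddingAdjoint τR τA ι a = 1 ∧ IsDensity τB b ∧
    t = (τM (ΦA.adjoint a * ΦB.adjoint b)).re}

/-- The constant `c`, the supremum of the overlaps. -/
def overlapConst {A B M R : Type*}
    [CStarAlgebra A] [PartialOrder A] [StarOrderedRing A]
    [CStarAlgebra B] [PartialOrder B] [StarOrderedRing B]
    [CStarAlgebra M] [PartialOrder M] [StarOrderedRing M] [FiniteDimensional ℂ M]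
    [CStarAlgebra R] [PartialOrder R] [StarOrderedRing R] [FiniteDimensional ℂ R]
    {τA : FaithfulTrace A} {τB : FaithfulTrace B} {τM : FaithfulTrace M} (τR : FaithfulTrace R)
    (ι : R →⋆ₐ[ℂ] A) (ΦA : QuantumChannel τM τA) (ΦB : QuantumChannel τM τB) : ℝ :=
  sSup (overlapSet τR ι ΦA ΦB)

end ChannelSSA

end

/-! The proof is a complex interpolation. Write `σ = Φ_A(ρ)`, `ω = Φ_B(ρ)`, `η = E_R(σ)`. When all
powers make sense, put `F(z) = τ_M(ρ · ρ^(-z/2) · Φ_B†(ω^(z/2)) · Φ_A†(η^(-z/2) σ^(z/2)))`. Then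
`F(0) = 1`, and `F'(0)` is half of `H(ρ) + H(η) - H(σ) - H(ω)`, so it suffices to show `Re F'(0) ≤
log √c`. This follows from the three lines theorem (`re_deriv_le_log_of_strip`) once `|F| ≤ 1` on
`Re z = 0` and `|F| ≤ √c` on `Re z = 1`.

Both bounds combine Cauchy–Schwarz with the Kadison–Schwarz inequality for the unital maps `Φ†`
(`star_adjoint_mul_le`). On the left line the powers are unitary, so their images are contractions.
On the right line the estimate reduces to an overlap with `a = v v*`, `v = η^(-z/2) σ^(z/2)`, and `b
= ω`. The bimodule property of `E_R` gives `E_R(a) = 1`, so the overlap is at most `c`.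

Non-invertible states are shifted by `ε`, at an entropy cost linear in `ε`. -/

noncomputable section

namespace ChannelSSA

open scoped ComplexOrder

/-! ### Positivity and Cauchy–Schwarz for faithful traces -/

section Trace

variable {M : Type*} [CStarAlgebra M] [PartialOrder M] [StarOrderedRing M]

/-- A faithful trace as a positive linear functional. -/
def FaithfulTrace.toPositive (τ : FaithfulTrace M) : M →ₚ[ℂ] ℂ :=
  PositiveLinearMap.mk₀ τ.toLinearMap τ.nonneg'

theorem FaithfulTrace.mul_comm (τ : FaithfulTrace M) (x y : M) : τ (x * y) = τ (y * x) :=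
  τ.mul_comm' x y

theorem FaithfulTrace.nonneg (τ : FaithfulTrace M) {x : M} (hx : 0 ≤ x) : 0 ≤ τ x :=
  τ.nonneg' x hx

theorem FaithfulTrace.eq_zero (τ : FaithfulTrace M) {x : M} (hx : 0 ≤ x) (h : τ x = 0) : x = 0 :=
  τ.faithful' x hx h

theorem FaithfulTrace.map_star (τ : FaithfulTrace M) (x : M) : τ (star x) = star (τ x) :=
  StarHomClass.map_star τ.toPositive x

theorem FaithfulTrace.re_mono (τ : FaithfulTrace M) {x y : M} (h : x ≤ y) :
    (τ x).re ≤ (τ y).re := by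
  have := (Complex.le_def.1 (τ.nonneg (sub_nonneg.2 h))).1
  rw [map_sub] at this
  simpa using this

theorem FaithfulTrace.mul_nonneg (τ : FaithfulTrace M) {x y : M} (hx : 0 ≤ x) (hy : 0 ≤ y) :
    0 ≤ τ (x * y) := by
  obtain ⟨s, rfl⟩ := CStarAlgebra.nonneg_iff_eq_star_mul_self.1 hx
  rw [mul_assoc, τ.mul_comm, mul_assoc]
  rw [← mul_assoc]
  exact τ.nonneg (star_right_conjugate_nonneg hy s)

theorem FaithfulTrace.re_mul_le_mul (τ : FaithfulTrace M) {x x' y y' : M} (hx : 0 ≤ x)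
    (hxx : x ≤ x') (hy : 0 ≤ y) (hyy : y ≤ y') : (τ (x * y)).re ≤ (τ (x' * y')).re := by
  have h1 := (Complex.le_def.1 (τ.mul_nonneg (sub_nonneg.2 hxx) hy)).1
  have h2 := (Complex.le_def.1 (τ.mul_nonneg (hx.trans hxx) (sub_nonneg.2 hyy))).1
  rw [sub_mul, map_sub] at h1
  rw [mul_sub, map_sub] at h2
  simp only [Complex.sub_re, Complex.zero_re] at h1 h2
  linarith

/-- An element is positive if its pairing with all positive elements is. -/
theorem FaithfulTrace.nonneg_of_forall_mul (τ : FaithfulTrace M) {z : M}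
    (h : ∀ m : M, 0 ≤ m → 0 ≤ τ (z * m)) : 0 ≤ z := by
  have hsa : IsSelfAdjoint z := by
    have hz : τ.toDual (star z) = τ.toDual z := by
      -- A positive functional preserves the star, so `z` and `star z` represent the same
      -- functional.
      let f : M →ₚ[ℂ] ℂ := PositiveLinearMap.mk₀ (τ.toDual z) (fun m hm => h m hm)
      ext m
      have h1 : f (star m) = star (f m) := StarHomClass.map_star f m
      have h2 : τ (z * star m) = star (τ (z * m)) := h1
      rw [τ.toDual_apply, τ.toDual_apply, τ.mul_comm (star z)]
      rw [show m * star z = star (z * star m) by simp, τ.map_star, h2, star_star]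
    exact τ.toDual_injective hz
  -- Testing against the negative part gives `-τ(z⁻ z⁻) ≥ 0`, so `z⁻` vanishes by faithfulness.
  have hneg : 0 ≤ τ (z * z⁻) := h _ (CFC.negPart_nonneg z)
  have hz : z * z⁻ = -(z⁻ * z⁻) := by
    calc z * z⁻ = (z⁺ - z⁻) * z⁻ := by rw [CFC.posPart_sub_negPart z hsa]
      _ = -(z⁻ * z⁻) := by rw [sub_mul, CFC.posPart_mul_negPart, zero_sub]
  rw [hz, map_neg] at hneg
  have hsq : 0 ≤ z⁻ * z⁻ := by
    have := star_mul_self_nonneg (z⁻)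
    rwa [(CFC.negPart_nonneg z).isSelfAdjoint.star_eq] at this
  have h0 : z⁻ * z⁻ = 0 := τ.eq_zero hsq (le_antisymm (by simpa using hneg) (τ.nonneg hsq))
  have h1 : z⁻ = 0 := by
    rw [← CStarRing.star_mul_self_eq_zero_iff, (CFC.negPart_nonneg z).isSelfAdjoint.star_eq, h0]
  rw [← CFC.posPart_sub_negPart z hsa, h1, sub_zero]
  exact CFC.posPart_nonneg z

/-- The Cauchy–Schwarz inequality for the trace inner product. -/
theorem FaithfulTrace.norm_star_mul_le (τ : FaithfulTrace M) (x y : M) :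
    ‖τ (star x * y)‖ ≤ √(τ (star x * x)).re * √(τ (star y * y)).re := by
  have h := norm_inner_le_norm (𝕜 := ℂ) (τ.toPositive.toPreGNS x) (τ.toPositive.toPreGNS y)
  rw [PositiveLinearMap.preGNS_inner_def, PositiveLinearMap.preGNS_norm_def,
    PositiveLinearMap.preGNS_norm_def] at h
  exact h

theorem FaithfulTrace.one_pos (τ : FaithfulTrace M) [Nontrivial M] : 0 < τ 1 :=
  lt_of_le_of_ne (τ.nonneg zero_le_one) fun h => one_ne_zero (τ.eq_zero zero_le_one h.symm)

theorem FaithfulTrace.ofReal_re (τ : FaithfulTrace M) {x : M} (hx : 0 ≤ x) :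
    (((τ x).re : ℝ) : ℂ) = τ x :=
  Complex.ext rfl (Complex.nonneg_iff.1 (τ.nonneg hx)).2

end Trace

/-! ### Adjoints of channels and the Kadison–Schwarz inequality -/

section Adjoint

variable {M : Type*} [CStarAlgebra M] [PartialOrder M] [StarOrderedRing M]
variable {N : Type*} [CStarAlgebra N] [PartialOrder N] [StarOrderedRing N]
variable {τM : FaithfulTrace M} {τN : FaithfulTrace N}

theorem QuantumChannel.map_nonneg (Φ : QuantumChannel τM τN) {x : M} (hx : 0 ≤ x) : 0 ≤ Φ x :=
  _root_.map_nonneg Φ.toCompletelyPositiveMap hx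

theorem QuantumChannel.trace_map (Φ : QuantumChannel τM τN) (x : M) : τN (Φ x) = τM x :=
  Φ.trace_preserving' x

/-- The quadratic form of a positive matrix over a C⋆-algebra has positive trace. -/
theorem FaithfulTrace.sum_mul_entry_nonneg (τ : FaithfulTrace N) {k : ℕ}
    {X : CStarMatrix (Fin k) (Fin k) N} (hX : 0 ≤ X) (y : Fin k → N) :
    0 ≤ ∑ i, ∑ j, τ (star (y j) * y i * X i j) := by
  rw [StarOrderedRing.nonneg_iff] at hX
  induction hX using AddSubmonoid.closure_induction with
  | zero => simp
  | add X Y _ _ hX hY =>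
    simpa [mul_add, Finset.sum_add_distrib] using add_nonneg hX hY
  | mem X hX =>
    obtain ⟨S, rfl⟩ := hX
    -- For a generator `star S * S` of the positive cone, cyclicity turns the form into a sum of
    -- squares, one for each row of `S`.
    have hsum : ∑ i, ∑ j, τ (star (y j) * y i * (star S * S) i j) =
        ∑ l, τ (star (∑ i, S l i * star (y i)) * ∑ j, S l j * star (y j)) := by
      have : ∀ i j, τ (star (y j) * y i * (star S * S) i j) =
          ∑ l, τ (star (S l i * star (y i)) * (S l j * star (y j))) := by
        intro i j
        rw [CStarMatrix.mul_apply, Finset.mul_sum, map_sum]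
        refine Finset.sum_congr rfl fun l _ => ?_
        rw [mul_assoc, τ.mul_comm]
        simp [mul_assoc, CStarMatrix.star_apply]
      simp_rw [this, star_sum, Finset.sum_mul_sum, map_sum]
      conv_rhs => rw [Finset.sum_comm]
      refine Finset.sum_congr rfl fun i _ => ?_
      rw [Finset.sum_comm]
    rw [hsum]
    exact Finset.sum_nonneg fun l _ => τ.nonneg (star_mul_self_nonneg _)

variable [FiniteDimensional ℂ M]

theorem traceAdjoint_nonneg {Φ : M →ₗ[ℂ] N} (hΦ : ∀ x, 0 ≤ x → 0 ≤ Φ x) {y : N} (hy : 0 ≤ y) :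
    0 ≤ traceAdjoint τM τN Φ y :=
  τM.nonneg_of_forall_mul fun m hm => by
    rw [traceAdjoint_spec]
    exact τN.mul_nonneg hy (hΦ m hm)

theorem QuantumChannel.adjoint_spec (Φ : QuantumChannel τM τN) (y : N) (x : M) :
    τM (Φ.adjoint y * x) = τN (y * Φ x) :=
  traceAdjoint_spec τM τN Φ.toLinearMap y x

theorem QuantumChannel.adjoint_nonneg (Φ : QuantumChannel τM τN) {y : N} (hy : 0 ≤ y) :
    0 ≤ Φ.adjoint y :=
  traceAdjoint_nonneg (fun _ hx => Φ.map_nonneg hx) hy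

theorem QuantumChannel.adjoint_one (Φ : QuantumChannel τM τN) : Φ.adjoint 1 = 1 := by
  apply τM.toDual_injective
  ext x
  rw [τM.toDual_apply, τM.toDual_apply, Φ.adjoint_spec, one_mul, one_mul, Φ.trace_map]

theorem QuantumChannel.adjoint_star (Φ : QuantumChannel τM τN) (y : N) :
    Φ.adjoint (star y) = star (Φ.adjoint y) :=
  StarHomClass.map_star (PositiveLinearMap.mk₀ Φ.adjoint fun _ hy => Φ.adjoint_nonneg hy) y

/-- Complete positivity, tested on Gram matrices and paired with the trace. -/
theorem QuantumChannel.trace_gram_nonneg (Φ : QuantumChannel τM τN) {k : ℕ} (p : Fin k → M)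
    (y : Fin k → N) :
    0 ≤ ∑ i, ∑ j, τM (Φ.adjoint (star (y j) * y i) * (star (p i) * p j)) := by
  let G : CStarMatrix (Fin k) (Fin k) M := CStarMatrix.ofMatrix fun i j => star (p i) * p j
  have hG : 0 ≤ G := by
    rcases k with _ | k
    · exact le_of_eq (by ext i; exact i.elim0)
    -- With `p` as first row and zeros elsewhere, `star S * S` is the Gram matrix; this needs an
    -- index `0`, hence the case split.
    · let S : CStarMatrix (Fin (k + 1)) (Fin (k + 1)) M :=
        CStarMatrix.ofMatrix fun i j => if i = 0 then p j else 0
      have hS : ∀ i j, S i j = if i = 0 then p j else 0 := fun _ _ => rfl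
      have : G = star S * S := by
        ext i j
        rw [CStarMatrix.mul_apply, Fin.sum_univ_succ]
        simp only [CStarMatrix.star_apply, hS]
        rw [show G i j = star (p i) * p j from rfl]
        simp
      rw [this]
      exact star_mul_self_nonneg S
  have h := τN.sum_mul_entry_nonneg (Φ.toCompletelyPositiveMap.map_cstarMatrix_nonneg G hG) y
  refine h.trans_eq (Finset.sum_congr rfl fun i _ => Finset.sum_congr rfl fun j _ => ?_)
  rw [Φ.adjoint_spec]
  rfl

/-- The Kadison–Schwarz inequality for the (unital) adjoint of a quantum channel. -/
theorem QuantumChannel.star_adjoint_mul_le (Φ : QuantumChannel τM τN) (y : N) :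
    star (Φ.adjoint y) * Φ.adjoint y ≤ Φ.adjoint (star y * y) := by
  rw [← sub_nonneg]
  refine τM.nonneg_of_forall_mul fun m hm => ?_
  obtain ⟨s, rfl⟩ := CStarAlgebra.nonneg_iff_eq_star_mul_self.1 hm
  -- With `X = τ(Φ†(y)* Φ†(y) s* s)`, the two cross terms are `-X` each and the last diagonal term
  -- is `X`; the total is the required difference paired with `s* s`.
  have h := Φ.trace_gram_nonneg ![s, -(s * star (Φ.adjoint y))] ![y, 1]
  simp only [Fin.sum_univ_two, Matrix.cons_val_zero, Matrix.cons_val_one, star_one, one_mul,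
    mul_one, Φ.adjoint_one, Φ.adjoint_star] at h
  have cyc : τM (star (Φ.adjoint y) * Φ.adjoint y * (star s * s)) =
      τM (Φ.adjoint y * (star s * s) * star (Φ.adjoint y)) := by
    rw [mul_assoc, τM.mul_comm]
  have e1 : τM (star (Φ.adjoint y) * (star (-(s * star (Φ.adjoint y))) * s)) =
      - τM (star (Φ.adjoint y) * Φ.adjoint y * (star s * s)) := by
    rw [← map_neg]; simp [mul_assoc]
  have e2 : τM (Φ.adjoint y * (star s * -(s * star (Φ.adjoint y)))) =
      - τM (star (Φ.adjoint y) * Φ.adjoint y * (star s * s)) := by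
    rw [cyc, ← map_neg]; simp [mul_assoc]
  have e3 : τM (star (-(s * star (Φ.adjoint y))) * -(s * star (Φ.adjoint y))) =
      τM (star (Φ.adjoint y) * Φ.adjoint y * (star s * s)) := by
    rw [cyc]; simp [mul_assoc]
  rw [sub_mul, map_sub]
  rw [e1, e2, e3] at h
  convert h using 1
  ring

theorem QuantumChannel.adjoint_mul_star_le (Φ : QuantumChannel τM τN) (y : N) :
    Φ.adjoint y * star (Φ.adjoint y) ≤ Φ.adjoint (y * star y) := by
  simpa [Φ.adjoint_star] using Φ.star_adjoint_mul_le (star y)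

end Adjoint

/-! ### The adjoint of the embedding -/

section Embedding

variable {A R : Type*}
  [CStarAlgebra A] [PartialOrder A] [StarOrderedRing A]
  [CStarAlgebra R] [PartialOrder R] [StarOrderedRing R] [FiniteDimensional ℂ R]
  {τA : FaithfulTrace A} {τR : FaithfulTrace R} {ι : R →⋆ₐ[ℂ] A}

theorem embeddingAdjoint_spec (a : A) (x : R) :
    τR (embeddingAdjoint τR τA ι a * x) = τA (a * ι x) :=
  traceAdjoint_spec τR τA (ι : R →ₐ[ℂ] A).toLinearMap a x

theorem trace_embeddingAdjoint (a : A) : τR (embeddingAdjoint τR τA ι a) = τA a := by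
  simpa using embeddingAdjoint_spec (τA := τA) (τR := τR) (ι := ι) a 1

theorem embeddingAdjoint_nonneg {a : A} (ha : 0 ≤ a) : 0 ≤ embeddingAdjoint τR τA ι a :=
  traceAdjoint_nonneg (fun _ hx => _root_.map_nonneg ι hx) ha

/-- The adjoint of the embedding is a bimodule map. -/
theorem embeddingAdjoint_mul_mul (r s : R) (a : A) :
    embeddingAdjoint τR τA ι (ι r * a * ι s) = r * embeddingAdjoint τR τA ι a * s := by
  apply τR.toDual_injective
  ext x
  calc τR (embeddingAdjoint τR τA ι (ι r * a * ι s) * x)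
      = τA (ι r * (a * (ι s * ι x))) := by rw [embeddingAdjoint_spec, mul_assoc, mul_assoc]
    _ = τA (a * ι (s * x * r)) := by rw [τA.mul_comm]; simp [mul_assoc]
    _ = τR (embeddingAdjoint τR τA ι a * (s * x) * r) := by
      rw [← embeddingAdjoint_spec (τR := τR)]; simp only [mul_assoc]
    _ = τR (r * embeddingAdjoint τR τA ι a * s * x) := by rw [τR.mul_comm]; simp only [mul_assoc]

/-- As `τR` need not be a restriction, `d = E_R(1)` need not be `1`. If `d x = 0`, then `τA(ι(x x*))
= τR(d x x*) = 0`, so `x = 0`; in finite dimensions injectivity of left multiplication by `d` gives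
an inverse. -/
theorem isStrictlyPositive_embeddingAdjoint_one (hι : Function.Injective ι) :
    IsStrictlyPositive (embeddingAdjoint τR τA ι 1) := by
  set d := embeddingAdjoint τR τA ι 1 with hd
  have h0 : 0 ≤ d := embeddingAdjoint_nonneg zero_le_one
  have hinj : Function.Injective (LinearMap.mulLeft ℂ d) := by
    rw [injective_iff_map_eq_zero]
    intro x hx
    have hx' : d * x = 0 := hx
    have h1 : τA (ι x * star (ι x)) = 0 := by
      have := embeddingAdjoint_spec (τA := τA) (τR := τR) (ι := ι) 1 (x * star x)
      rw [← hd, ← mul_assoc, hx', zero_mul, map_zero, one_mul, map_mul, StarHomClass.map_star]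
        at this
      exact this.symm
    have h2 := τA.eq_zero (mul_star_self_nonneg _) h1
    rw [CStarRing.mul_star_self_eq_zero_iff] at h2
    exact hι (by rw [h2, map_zero])
  obtain ⟨e, he⟩ := LinearMap.surjective_of_injective hinj 1
  have he : d * e = 1 := he
  have hleft_inv : star e * d = 1 := by
    have := congrArg star he
    rwa [star_mul, h0.isSelfAdjoint.star_eq, star_one] at this
  exact ⟨h0, isUnit_iff_exists_and_exists.2 ⟨⟨e, he⟩, ⟨star e, hleft_inv⟩⟩⟩

/-- There is a strictly positive element with conditional marginal `1`. -/
theorem exists_embeddingAdjoint_eq_one (hι : Function.Injective ι) :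
    ∃ a : A, IsStrictlyPositive a ∧ embeddingAdjoint τR τA ι a = 1 := by
  obtain ⟨h0, hu⟩ := IsStrictlyPositive.iff_of_unital.1
    (isStrictlyPositive_embeddingAdjoint_one (τA := τA) (τR := τR) hι)
  obtain ⟨u, hu⟩ := hu
  rw [← hu] at h0
  have hpos : 0 ≤ (↑u⁻¹ : R) := by
    have := star_left_conjugate_nonneg h0 (↑u⁻¹ : R)
    rw [mul_assoc, Units.mul_inv, mul_one] at this
    simpa using star_nonneg_iff.2 this
  -- The witness is `ι(d⁻¹)`: by the bimodule property its image is `d⁻¹ d = 1`.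
  refine ⟨ι ↑u⁻¹,
    IsStrictlyPositive.iff_of_unital.2 ⟨_root_.map_nonneg ι hpos, u⁻¹.isUnit.map ι⟩, ?_⟩
  have := embeddingAdjoint_mul_mul (τA := τA) (τR := τR) (ι := ι) (↑u⁻¹) 1 1
  rw [← hu] at this
  simpa using this

end Embedding

/-! ### Finiteness and positivity of the overlap constant -/

/-- In finite dimensions the norm of a positive element is controlled by its trace. -/
theorem FaithfulTrace.exists_norm_le {M : Type*} [CStarAlgebra M] [PartialOrder M]
    [StarOrderedRing M] [FiniteDimensional ℂ M] (τ : FaithfulTrace M) :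
    ∃ C : ℝ, ∀ x : M, 0 ≤ x → ‖x‖ ≤ C * (τ x).re := by
  have : ProperSpace M := FiniteDimensional.proper ℂ M
  have hcont : Continuous fun x : M => (τ x).re :=
    Complex.continuous_re.comp (LinearMap.continuous_of_finiteDimensional τ.toLinearMap)
  have hK : IsCompact (Metric.sphere (0 : M) 1 ∩ {x | 0 ≤ x}) :=
    (isCompact_sphere 0 1).inter_right isClosed_Ici
  rcases (Metric.sphere (0 : M) 1 ∩ {x | 0 ≤ x}).eq_empty_or_nonempty with hE | hE
  · refine ⟨0, fun x hx => ?_⟩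
    by_contra h
    have hx0 : 0 < ‖x‖ := by simpa using h
    have : (‖x‖⁻¹ : ℝ) • x ∈ Metric.sphere (0 : M) 1 ∩ {x | 0 ≤ x} :=
      ⟨by simp [norm_smul, hx0.ne'], smul_nonneg (by positivity) hx⟩
    simp [hE] at this
  -- The trace attains a minimum on the compact set of positive unit vectors, nonzero by
  -- faithfulness; its inverse is the constant.
  · obtain ⟨m, ⟨hm1, hm0⟩, hmin⟩ := hK.exists_isMinOn hE hcont.continuousOn
    have hm : 0 < (τ m).re := by
      refine lt_of_le_of_ne (Complex.nonneg_iff.1 (τ.nonneg hm0)).1 fun h => ?_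
      have := τ.eq_zero hm0 (by rw [← τ.ofReal_re hm0, ← h, Complex.ofReal_zero])
      simp [this] at hm1
    refine ⟨(τ m).re⁻¹, fun x hx => ?_⟩
    rcases (norm_nonneg x).eq_or_lt with h | hx0
    · rw [← h]
      exact _root_.mul_nonneg (inv_nonneg.2 hm.le) (Complex.nonneg_iff.1 (τ.nonneg hx)).1
    · have hle : (τ m).re ≤ (τ ((‖x‖⁻¹ : ℝ) • x)).re :=
        hmin (a := (‖x‖⁻¹ : ℝ) • x)
          ⟨by simp [norm_smul, hx0.ne'], smul_nonneg (by positivity) hx⟩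
      rw [← Complex.coe_smul, map_smul, Complex.coe_smul, Complex.smul_re, smul_eq_mul] at hle
      rw [inv_mul_eq_div, le_div_iff₀ hm]
      rwa [inv_mul_eq_div, le_div_iff₀ hx0, _root_.mul_comm] at hle

section Overlap

variable {A B M R : Type*}
  [CStarAlgebra A] [PartialOrder A] [StarOrderedRing A]
  [CStarAlgebra B] [PartialOrder B] [StarOrderedRing B]
  [CStarAlgebra M] [PartialOrder M] [StarOrderedRing M] [FiniteDimensional ℂ M]
  [CStarAlgebra R] [PartialOrder R] [StarOrderedRing R] [FiniteDimensional ℂ R]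
  {τA : FaithfulTrace A} {τB : FaithfulTrace B} {τM : FaithfulTrace M} {τR : FaithfulTrace R}
  {ι : R →⋆ₐ[ℂ] A} (ΦA : QuantumChannel τM τA) (ΦB : QuantumChannel τM τB)

/-- Take an invertible admissible `a ≥ δ > 0` and `b = 1/τB(1)`; unitality of the adjoints makes the
overlap at least `δ τM(1)/τB(1)`. -/
theorem exists_pos_mem_overlapSet [Nontrivial M] (hι : Function.Injective ι) :
    ∃ t ∈ overlapSet τR ι ΦA ΦB, 0 < t := by
  obtain ⟨a, ha, hEa⟩ := exists_embeddingAdjoint_eq_one (τA := τA) (τR := τR) hι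
  have hB : Nontrivial B := by
    by_contra h
    rw [not_nontrivial_iff_subsingleton] at h
    have h1 := ΦB.trace_map 1
    rw [Subsingleton.elim (ΦB 1) 0, map_zero] at h1
    exact τM.one_pos.ne h1
  have hA : Nontrivial A := by
    by_contra h
    rw [not_nontrivial_iff_subsingleton] at h
    have h1 := ΦA.trace_map 1
    rw [Subsingleton.elim (ΦA 1) 0, map_zero] at h1
    exact τM.one_pos.ne h1
  have hB1 : 0 < (τB 1).re := (Complex.pos_iff.1 τB.one_pos).1
  have hM1 : 0 < (τM 1).re := (Complex.pos_iff.1 τM.one_pos).1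
  obtain ⟨δ, hδ, hδa⟩ := (CFC.exists_pos_algebraMap_le_iff (a := a) ha.isSelfAdjoint).2
    fun x hx => ha.spectrum_pos hx
  have hb0 : (0 : B) ≤ (((τB 1).re⁻¹ : ℝ) : ℂ) • (1 : B) := by
    rw [Complex.coe_smul]
    exact smul_nonneg (by positivity) zero_le_one
  refine ⟨_, ⟨a, (((τB 1).re⁻¹ : ℝ) : ℂ) • (1 : B), ha.nonneg, hEa, ⟨hb0, ?_⟩, rfl⟩, ?_⟩
  · rw [map_smul, ← τB.ofReal_re zero_le_one, smul_eq_mul, ← Complex.ofReal_mul,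
      Complex.ofReal_re, inv_mul_cancel₀ hB1.ne', Complex.ofReal_one]
  · have h1 : ((δ : ℝ) : ℂ) • (1 : M) ≤ ΦA.adjoint a := by
      rw [Algebra.algebraMap_eq_smul_one, ← Complex.coe_smul] at hδa
      have := ΦA.adjoint_nonneg (sub_nonneg.2 hδa)
      rw [map_sub, map_smul, ΦA.adjoint_one] at this
      exact sub_nonneg.1 this
    have h2 := τM.re_mono h1
    rw [map_smul, smul_eq_mul, Complex.re_ofReal_mul] at h2
    rw [map_smul, ΦB.adjoint_one, mul_smul_comm, mul_one, map_smul, smul_eq_mul,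
      Complex.re_ofReal_mul]
    exact mul_pos (by positivity) (lt_of_lt_of_le (mul_pos hδ hM1) h2)

variable [FiniteDimensional ℂ B]

/-- The norm of a density is at most a constant `C`, so `Φ_B†(b) ≤ C`. What remains is `τA(a Φ_A(1))
≤ ‖Φ_A(1)‖ τA(a)`, and `τA(a) = τR(E_R(a)) = τR(1)` is fixed. -/
theorem bddAbove_overlapSet : BddAbove (overlapSet τR ι ΦA ΦB) := by
  obtain ⟨C, hC⟩ := τB.exists_norm_le
  refine ⟨C * (‖ΦA 1‖ * (τR 1).re), ?_⟩
  rintro t ⟨a, b, ha, hEa, ⟨hb, hb1⟩, rfl⟩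
  have hbC : ‖b‖ ≤ C := by simpa [hb1] using hC b hb
  have hTb : ΦB.adjoint b ≤ (‖b‖ : ℂ) • (1 : M) := by
    have h1 : b ≤ (‖b‖ : ℂ) • (1 : B) := by
      rw [Complex.coe_smul, ← Algebra.algebraMap_eq_smul_one]
      exact IsSelfAdjoint.le_algebraMap_norm_self hb.isSelfAdjoint
    have := ΦB.adjoint_nonneg (sub_nonneg.2 h1)
    rw [map_sub, map_smul, ΦB.adjoint_one] at this
    exact sub_nonneg.1 this
  have hΦ1 : ΦA 1 ≤ (‖ΦA 1‖ : ℂ) • (1 : A) := by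
    rw [Complex.coe_smul, ← Algebra.algebraMap_eq_smul_one]
    exact IsSelfAdjoint.le_algebraMap_norm_self (ΦA.map_nonneg zero_le_one).isSelfAdjoint
  have hτa : 0 ≤ (τA a).re := (Complex.nonneg_iff.1 (τA.nonneg ha)).1
  have h1 := τM.re_mul_le_mul (ΦA.adjoint_nonneg ha) le_rfl (ΦB.adjoint_nonneg hb) hTb
  have h2 := τA.re_mul_le_mul ha le_rfl (ΦA.map_nonneg zero_le_one) hΦ1
  rw [mul_smul_comm, map_smul, smul_eq_mul, Complex.re_ofReal_mul, ΦA.adjoint_spec a 1] at h1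
  rw [mul_smul_comm, map_smul, smul_eq_mul, Complex.re_ofReal_mul, mul_one] at h2
  have h3 : (τR 1).re = (τA a).re := by
    rw [← hEa, trace_embeddingAdjoint]
  rw [h3]
  refine h1.trans ((mul_le_mul_of_nonneg_left h2 (norm_nonneg b)).trans ?_)
  exact mul_le_mul_of_nonneg_right hbC (mul_nonneg (norm_nonneg _) hτa)

theorem isLUB_overlapConst [Nontrivial M] (hι : Function.Injective ι) :
    IsLUB (overlapSet τR ι ΦA ΦB) (overlapConst τR ι ΦA ΦB) := by
  obtain ⟨t, ht, -⟩ := exists_pos_mem_overlapSet (τR := τR) ΦA ΦB hι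
  exact isLUB_csSup ⟨t, ht⟩ (bddAbove_overlapSet ΦA ΦB)

theorem overlapConst_pos [Nontrivial M] (hι : Function.Injective ι) :
    0 < overlapConst τR ι ΦA ΦB := by
  obtain ⟨t, ht, h0⟩ := exists_pos_mem_overlapSet (τR := τR) ΦA ΦB hι
  exact h0.trans_le (le_csSup (bddAbove_overlapSet ΦA ΦB) ht)

/-- The overlap bound for an unnormalized second argument. -/
theorem re_trace_adjoint_mul_le {a : A} {b : B} (ha : 0 ≤ a)
    (hEa : embeddingAdjoint τR τA ι a = 1) (hb : 0 ≤ b) :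
    (τM (ΦA.adjoint a * ΦB.adjoint b)).re ≤ overlapConst τR ι ΦA ΦB * (τB b).re := by
  rcases (Complex.nonneg_iff.1 (τB.nonneg hb)).1.eq_or_lt with h | h
  · have hb0 : b = 0 := τB.eq_zero hb (by rw [← τB.ofReal_re hb, ← h, Complex.ofReal_zero])
    simp [hb0]
  · have hmem : (τB b).re⁻¹ * (τM (ΦA.adjoint a * ΦB.adjoint b)).re ∈ overlapSet τR ι ΦA ΦB := by
      refine ⟨a, (((τB b).re⁻¹ : ℝ) : ℂ) • b, ha, hEa, ⟨?_, ?_⟩, ?_⟩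
      · rw [Complex.coe_smul]
        exact smul_nonneg (by positivity) hb
      · rw [map_smul, ← τB.ofReal_re hb, smul_eq_mul, ← Complex.ofReal_mul,
          Complex.ofReal_re, inv_mul_cancel₀ h.ne', Complex.ofReal_one]
      · rw [map_smul, mul_smul_comm, map_smul, smul_eq_mul, Complex.re_ofReal_mul]
    have := le_csSup (bddAbove_overlapSet ΦA ΦB) hmem
    rwa [inv_mul_le_iff₀ h, mul_comm] at this

end Overlap

/-! ### Complex powers and the three lines theorem -/

open NormedSpace in
theorem exp_add_smul {M : Type*} [CStarAlgebra M] (L : M) (z w : ℂ) :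
    exp ((z + w) • L) = exp (z • L) * exp (w • L) := by
  let _ : NormedAlgebra ℚ M := .restrictScalars ℚ ℂ M
  rw [add_smul]
  exact exp_add_of_commute (((Commute.refl L).smul_left z).smul_right w)

open NormedSpace in
theorem star_exp_smul {M : Type*} [CStarAlgebra M] {L : M} (hL : IsSelfAdjoint L) (z : ℂ) :
    star (exp (z • L)) = exp (star z • L) := by
  rw [star_exp, star_smul, hL.star_eq]

-- The modulus of a complex power depends only on `re z`; on the imaginary axis the power is
-- unitary.
open NormedSpace in
theorem star_exp_smul_mul {M : Type*} [CStarAlgebra M] {L : M} (hL : IsSelfAdjoint L) (z : ℂ) :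
    star (exp (z • L)) * exp (z • L) = exp (((2 * z.re : ℝ) : ℂ) • L) := by
  rw [star_exp_smul hL, ← exp_add_smul]
  congr 2
  apply Complex.ext <;> simp [two_mul]

open NormedSpace in
theorem exp_smul_mul_star {M : Type*} [CStarAlgebra M] {L : M} (hL : IsSelfAdjoint L) (z : ℂ) :
    exp (z • L) * star (exp (z • L)) = exp (((2 * z.re : ℝ) : ℂ) • L) := by
  rw [star_exp_smul hL, ← exp_add_smul]
  congr 2
  apply Complex.ext <;> simp [two_mul]

open NormedSpace in
/-- Complex powers are bounded on vertical strips. -/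
theorem exists_norm_exp_smul_le {M : Type*} [CStarAlgebra M] {L : M} (hL : IsSelfAdjoint L) :
    ∃ C : ℝ, ∀ z : ℂ, |z.re| ≤ 1 → ‖exp (z • L)‖ ≤ C := by
  have hcont : Continuous fun z : ℂ => exp (z • L) :=
    continuous_iff_continuousAt.2 fun z => (hasDerivAt_exp_smul_const (𝕂 := ℂ) L z).continuousAt
  obtain ⟨C, hC⟩ := ((isCompact_closedBall (0 : ℂ) 2).image
    (continuous_norm.comp hcont)).bddAbove
  -- The C⋆-identity replaces `z` by the real exponent `2 re z`, which lies in `[-2, 2]`; hence the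
  -- radius `2` and the square root.
  refine ⟨√C, fun z hz => Real.le_sqrt_of_sq_le ?_⟩
  rw [sq, ← CStarRing.norm_star_mul_self, star_exp_smul_mul hL]
  refine hC ⟨((2 * z.re : ℝ) : ℂ), ?_, rfl⟩
  rw [mem_closedBall_zero_iff, Complex.norm_real, Real.norm_eq_abs, abs_mul, abs_two]
  linarith

/-- A function on the strip `0 ≤ re z ≤ 1` with value `1` at `0` and norm at most `1` and `K` on
the two boundary lines has derivative at most `log K` at `0`. -/
theorem re_deriv_le_log_of_strip {F : ℂ → ℂ} {F' : ℂ} {K : ℝ} (hK : 0 < K)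
    (hF : Differentiable ℂ F)
    (hB : BddAbove ((norm ∘ F) '' Complex.HadamardThreeLines.verticalClosedStrip 0 1))
    (h0 : ∀ z : ℂ, z.re = 0 → ‖F z‖ ≤ 1) (h1 : ∀ z : ℂ, z.re = 1 → ‖F z‖ ≤ K)
    (hF0 : F 0 = 1) (hF' : HasDerivAt F F' 0) : F'.re ≤ Real.log K := by
  have hle : ∀ x ∈ Set.Icc (0 : ℝ) 1, (F x).re ≤ K ^ x := by
    intro x hx
    have := Complex.HadamardThreeLines.norm_le_interp_of_mem_verticalClosedStrip₀₁' F
      (z := (x : ℂ)) (by simpa [Complex.HadamardThreeLines.verticalClosedStrip] using hx)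
      hF.diffContOnCl hB h0 h1
    rw [Real.one_rpow, one_mul, Complex.ofReal_re] at this
    exact (Complex.re_le_norm _).trans this
  have hd1 : HasDerivAt (fun x : ℝ => (F x).re) F'.re 0 := by
    have : HasDerivAt F F' ((0 : ℝ) : ℂ) := by simpa using hF'
    exact this.real_of_complex
  have hd2 : HasDerivAt (fun x : ℝ => K ^ x) (Real.log K) 0 := by
    simpa using (hasDerivAt_id (0 : ℝ)).const_rpow hK
  -- `K ^ x - re F(x)` is nonnegative on `[0, 1]` and vanishes at `0`, so its right derivative there
  -- is nonnegative.
  have hd := (hd2.sub hd1).hasDerivWithinAt (s := Set.Ioi 0)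
  rw [hasDerivWithinAt_iff_tendsto_slope' (by simp)] at hd
  have : 0 ≤ Real.log K - F'.re := by
    refine ge_of_tendsto hd ?_
    filter_upwards [Ioo_mem_nhdsGT (zero_lt_one' ℝ)] with x hx
    rw [slope_def_field]
    have := hle x ⟨hx.1.le, hx.2.le⟩
    simp only [Pi.sub_apply, Real.rpow_zero, Complex.ofReal_zero, hF0, Complex.one_re, sub_self,
      sub_zero]
    exact div_nonneg (sub_nonneg.2 this) hx.1.le
  linarith

/-- The left-boundary estimate: contractions between two halves of a state. -/
theorem FaithfulTrace.norm_mul_le_one {M : Type*} [CStarAlgebra M] [PartialOrder M]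
    [StarOrderedRing M] {τM : FaithfulTrace M} {ρ U X Y : M} (hρ : IsDensity τM ρ)
    (hU : U * star U = 1)
    (hX : X * star X ≤ 1) (hY : star Y * Y ≤ 1) : ‖τM (ρ * U * X * Y)‖ ≤ 1 := by
  set s := CFC.sqrt ρ with hs
  have hs0 : star s = s := (CFC.sqrt_nonneg ρ).isSelfAdjoint.star_eq
  have hss : s * s = ρ := CFC.sqrt_mul_sqrt_self ρ hρ.1
  have hre : (τM (s * s)).re = 1 := by rw [hss, hρ.2, Complex.one_re]
  -- With `ρ = s s`, cyclicity makes the trace an inner product of two vectors, each of norm at most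
  -- `τ(ρ)^(1/2) = 1`.
  have h := τM.norm_star_mul_le (star X * star U * s) (Y * s)
  have e1 : τM (ρ * U * X * Y) = τM (star (star X * star U * s) * (Y * s)) := by
    rw [← hss]
    simp only [star_mul, star_star, hs0, mul_assoc]
    rw [τM.mul_comm s]
    simp only [mul_assoc]
  have h1 : (τM (star (star X * star U * s) * (star X * star U * s))).re ≤ 1 := by
    have := τM.re_mono (star_left_conjugate_le_conjugate hX (star U * s))
    refine (le_of_eq ?_).trans (this.trans_eq ?_)
    · simp [mul_assoc]
    · rw [mul_one, star_mul, star_star, hs0, ← mul_assoc, mul_assoc s, hU, mul_one, hre]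
  have h2 : (τM (star (Y * s) * (Y * s))).re ≤ 1 := by
    have := τM.re_mono (star_left_conjugate_le_conjugate hY s)
    refine (le_of_eq ?_).trans (this.trans_eq ?_)
    · simp [mul_assoc]
    · rw [mul_one, hs0, hre]
  rw [e1]
  refine h.trans (mul_le_one₀ ?_ (Real.sqrt_nonneg _) ?_) <;>
  · rw [Real.sqrt_le_one]
    assumption

/-! ### The interpolation bound -/

section Interpolation

variable {A B M R : Type*}
  [CStarAlgebra A] [PartialOrder A] [StarOrderedRing A]
  [CStarAlgebra B] [PartialOrder B] [StarOrderedRing B] [FiniteDimensional ℂ B]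
  [CStarAlgebra M] [PartialOrder M] [StarOrderedRing M] [FiniteDimensional ℂ M]
  [CStarAlgebra R] [PartialOrder R] [StarOrderedRing R] [FiniteDimensional ℂ R]
  {τA : FaithfulTrace A} {τB : FaithfulTrace B} {τM : FaithfulTrace M} {τR : FaithfulTrace R}
  {ι : R →⋆ₐ[ℂ] A} (ΦA : QuantumChannel τM τA) (ΦB : QuantumChannel τM τB)

/-- The right-boundary estimate. -/
theorem norm_trace_mul_le_sqrt_overlap {W : M} {v : A} {y : B}
    (hW : (τM (W * star W)).re ≤ 1) (hv : embeddingAdjoint τR τA ι (v * star v) = 1) :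
    ‖τM (W * ΦB.adjoint y * ΦA.adjoint v)‖ ≤
      √(overlapConst τR ι ΦA ΦB * (τB (star y * y)).re) := by
  have h := τM.norm_star_mul_le (star W) (ΦB.adjoint y * ΦA.adjoint v)
  rw [star_star] at h
  rw [mul_assoc]
  refine h.trans ((mul_le_of_le_one_left (Real.sqrt_nonneg _) (Real.sqrt_le_one.2 hW)).trans
    (Real.sqrt_le_sqrt ?_))
  -- Cyclicity exposes a product of two positive elements, so Kadison–Schwarz can be applied to each
  -- factor separately.
  have e : τM (star (ΦB.adjoint y * ΦA.adjoint v) * (ΦB.adjoint y * ΦA.adjoint v)) =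
      τM ((ΦA.adjoint v * star (ΦA.adjoint v)) * (star (ΦB.adjoint y) * ΦB.adjoint y)) := by
    rw [τM.mul_comm (ΦA.adjoint v * star _), ← mul_assoc _ (ΦA.adjoint v),
      τM.mul_comm _ (star (ΦA.adjoint v))]
    simp [mul_assoc]
  rw [e]
  exact (τM.re_mul_le_mul (mul_star_self_nonneg _) (ΦA.adjoint_mul_star_le v)
    (star_mul_self_nonneg _) (ΦB.star_adjoint_mul_le y)).trans
    (re_trace_adjoint_mul_le ΦA ΦB (mul_star_self_nonneg v) hv (star_mul_self_nonneg y))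

open NormedSpace in
/-- The interpolation bound, for logarithms `Lρ`, `Lω`, `Lσ`, `Lη` of invertible positive
elements. -/
theorem re_trace_mul_logs_le [FiniteDimensional ℂ A] [Nontrivial M]
    (hι : Function.Injective ι) {ρ Lρ : M} {Lω : B}
    {Lσ : A} {Lη : R} (hρ : IsDensity τM ρ)
    (hLρ : IsSelfAdjoint Lρ) (hLω : IsSelfAdjoint Lω) (hLσ : IsSelfAdjoint Lσ)
    (hLη : IsSelfAdjoint Lη) (hexpρ : (τM (ρ * exp (-Lρ) * ρ)).re ≤ 1)
    (hexpω : 0 < (τB (exp Lω)).re) (hE : embeddingAdjoint τR τA ι (exp Lσ) = exp Lη) :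
    (τM (ρ * (-Lρ + ΦB.adjoint Lω + ΦA.adjoint (Lσ - ι Lη)))).re ≤
      Real.log (overlapConst τR ι ΦA ΦB * (τB (exp Lω)).re) := by
  set c := overlapConst τR ι ΦA ΦB * (τB (exp Lω)).re with hc
  have hc0 : 0 < c := mul_pos (overlapConst_pos ΦA ΦB hι) hexpω
  let τc : M →L[ℂ] ℂ := τM.toLinearMap.toContinuousLinearMap
  let TA : A →L[ℂ] M := ΦA.adjoint.toContinuousLinearMap
  let TB : B →L[ℂ] M := ΦB.adjoint.toContinuousLinearMap
  let ic : R →L[ℂ] A := (ι : R →ₐ[ℂ] A).toLinearMap.toContinuousLinearMap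
  -- Factoring `F` through a continuous map on a finite-dimensional space reduces its boundedness on
  -- the strip to compactness of balls.
  let G : M × B × R × A → ℂ := fun q => τc (ρ * q.1 * TB q.2.1 * TA (ic q.2.2.1 * q.2.2.2))
  have hG : Continuous G := by fun_prop
  -- Half-logarithms, so that on `re z = 1` the squared moduli are the full exponentials.
  let Kρ : M := (2⁻¹ : ℂ) • (-Lρ)
  let Kω : B := (2⁻¹ : ℂ) • Lω
  let Kσ : A := (2⁻¹ : ℂ) • Lσ
  let Kη : R := (2⁻¹ : ℂ) • (-Lη)
  have h2 : IsSelfAdjoint (2⁻¹ : ℂ) := by simp [isSelfAdjoint_iff]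
  have hKρ : IsSelfAdjoint Kρ := h2.smul hLρ.neg
  have hKω : IsSelfAdjoint Kω := h2.smul hLω
  have hKσ : IsSelfAdjoint Kσ := h2.smul hLσ
  have hKη : IsSelfAdjoint Kη := h2.smul hLη.neg
  let F : ℂ → ℂ := fun z => G (exp (z • Kρ), exp (z • Kω), exp (z • Kη), exp (z • Kσ))
  have hderiv : ∀ z, HasDerivAt F (τc (
      (ρ * (exp (z • Kρ) * Kρ) * TB (exp (z • Kω)) + ρ * exp (z • Kρ) * TB (exp (z • Kω) * Kω)) *
        TA (ic (exp (z • Kη)) * exp (z • Kσ)) +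
      ρ * exp (z • Kρ) * TB (exp (z • Kω)) * TA (ic (exp (z • Kη) * Kη) * exp (z • Kσ) +
        ic (exp (z • Kη)) * (exp (z • Kσ) * Kσ)))) z := by
    intro z
    have d1 := (hasDerivAt_exp_smul_const (𝕂 := ℂ) Kρ z).const_mul ρ
    have d2 := TB.hasFDerivAt.comp_hasDerivAt z (hasDerivAt_exp_smul_const (𝕂 := ℂ) Kω z)
    have d3 := ic.hasFDerivAt.comp_hasDerivAt z (hasDerivAt_exp_smul_const (𝕂 := ℂ) Kη z)
    have d4 := hasDerivAt_exp_smul_const (𝕂 := ℂ) Kσ z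
    have d5 := TA.hasFDerivAt.comp_hasDerivAt z (d3.mul d4)
    exact τc.hasFDerivAt.comp_hasDerivAt z ((d1.mul d2).mul d5)
  have hF0 : F 0 = 1 := by
    have : F 0 = τM (ρ * ΦB.adjoint 1 * ΦA.adjoint (ι 1)) := by
      simp [F, G, τc, TA, TB, ic]
    rw [this, ΦB.adjoint_one, map_one, ΦA.adjoint_one, mul_one, mul_one, hρ.2]
  have hbdd : BddAbove ((norm ∘ F) '' Complex.HadamardThreeLines.verticalClosedStrip 0 1) := by
    have : ProperSpace M := FiniteDimensional.proper ℂ M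
    have : ProperSpace A := FiniteDimensional.proper ℂ A
    have : ProperSpace B := FiniteDimensional.proper ℂ B
    have : ProperSpace R := FiniteDimensional.proper ℂ R
    obtain ⟨Cρ, hCρ⟩ := exists_norm_exp_smul_le hKρ
    obtain ⟨Cω, hCω⟩ := exists_norm_exp_smul_le hKω
    obtain ⟨Cη, hCη⟩ := exists_norm_exp_smul_le hKη
    obtain ⟨Cσ, hCσ⟩ := exists_norm_exp_smul_le hKσ
    have hcomp := ((isCompact_closedBall (0 : M) Cρ).prod
      ((isCompact_closedBall (0 : B) Cω).prod
      ((isCompact_closedBall (0 : R) Cη).prod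
      (isCompact_closedBall (0 : A) Cσ)))).image (continuous_norm.comp hG)
    refine hcomp.bddAbove.mono ?_
    rintro _ ⟨z, hz, rfl⟩
    have hz1 : |z.re| ≤ 1 := abs_le.2 ⟨by linarith [hz.1], hz.2⟩
    refine ⟨_, ⟨?_, ?_, ?_, ?_⟩, rfl⟩ <;> rw [mem_closedBall_zero_iff]
    · exact hCρ z hz1
    · exact hCω z hz1
    · exact hCη z hz1
    · exact hCσ z hz1
  have hFz : ∀ z, F z = τM (ρ * exp (z • Kρ) * ΦB.adjoint (exp (z • Kω)) *
    ΦA.adjoint (ι (exp (z • Kη)) * exp (z • Kσ))) := fun z => rfl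
  have hleft : ∀ z : ℂ, z.re = 0 → ‖F z‖ ≤ 1 := by
    intro z hz
    rw [hFz]
    refine FaithfulTrace.norm_mul_le_one hρ (by rw [exp_smul_mul_star hKρ]; simp [hz])
      ((ΦB.adjoint_mul_star_le _).trans_eq ?_) ((ΦA.star_adjoint_mul_le _).trans_eq ?_)
    · rw [exp_smul_mul_star hKω]
      simp [hz, ΦB.adjoint_one]
    · rw [star_mul, ← StarHomClass.map_star, mul_assoc, ← mul_assoc (ι _), ← map_mul,
        star_exp_smul_mul hKη]
      have : exp (((2 * z.re : ℝ) : ℂ) • Kη) = 1 := by simp [hz]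
      rw [this, map_one, one_mul, star_exp_smul_mul hKσ]
      simp [hz, ΦA.adjoint_one]
  have htwo : ∀ z : ℂ, z.re = 1 → (((2 * z.re : ℝ) : ℂ) * 2⁻¹) = 1 := by
    intro z hz
    simp [hz]
  have hright : ∀ z : ℂ, z.re = 1 → ‖F z‖ ≤ √c := by
    intro z hz
    rw [hFz]
    have hω : exp Lω = star (exp (z • Kω)) * exp (z • Kω) := by
      rw [star_exp_smul_mul hKω, smul_smul, htwo z hz, one_smul]
    have hσ : exp (z • Kσ) * star (exp (z • Kσ)) = exp Lσ := by
      rw [exp_smul_mul_star hKσ, smul_smul, htwo z hz, one_smul]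
    rw [hc, hω]
    refine norm_trace_mul_le_sqrt_overlap ΦA ΦB ?_ ?_
    · rw [star_mul, mul_assoc, ← mul_assoc (exp _), exp_smul_mul_star hKρ, smul_smul, htwo z hz,
        one_smul, hρ.1.isSelfAdjoint.star_eq, ← mul_assoc]
      exact hexpρ
    -- The bimodule property pulls out the powers of `exp Lη`. In units of `Kη` the exponents are
    -- `z`, `-2` and `star z`, which cancel when `re z = 1`.
    · rw [star_mul, ← StarHomClass.map_star, mul_assoc, ← mul_assoc (exp (z • Kσ)),
        hσ, ← mul_assoc,
        embeddingAdjoint_mul_mul, hE, star_exp_smul hKη]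
      have hη : exp Lη = exp ((-2 : ℂ) • Kη) := by
        rw [smul_smul]
        norm_num
      rw [hη, ← exp_add_smul, ← exp_add_smul]
      have : z + -2 + star z = 0 := by
        apply Complex.ext <;> simp [hz]
        norm_num
      rw [this, zero_smul, exp_zero]
  have key := re_deriv_le_log_of_strip (Real.sqrt_pos.2 hc0) (fun z => (hderiv z).differentiableAt)
    hbdd hleft hright hF0 (hderiv 0)
  rw [Real.log_sqrt hc0.le] at key
  -- At `z = 0` every exponential is `1`. The remaining factor `1/2` matches `log √c = (log c)/2`.
  have hval : τc (
      (ρ * (exp ((0 : ℂ) • Kρ) * Kρ) * TB (exp ((0 : ℂ) • Kω)) +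
        ρ * exp ((0 : ℂ) • Kρ) * TB (exp ((0 : ℂ) • Kω) * Kω)) *
        TA (ic (exp ((0 : ℂ) • Kη)) * exp ((0 : ℂ) • Kσ)) +
      ρ * exp ((0 : ℂ) • Kρ) * TB (exp ((0 : ℂ) • Kω)) *
        TA (ic (exp ((0 : ℂ) • Kη) * Kη) * exp ((0 : ℂ) • Kσ) +
        ic (exp ((0 : ℂ) • Kη)) * (exp ((0 : ℂ) • Kσ) * Kσ))) =
      ((2⁻¹ : ℝ) : ℂ) * τM (ρ * (-Lρ + ΦB.adjoint Lω + ΦA.adjoint (Lσ - ι Lη))) := by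
    have hT : TA 1 = 1 := ΦA.adjoint_one
    have hT' : TB 1 = 1 := ΦB.adjoint_one
    have hi : ic 1 = 1 := map_one ι
    have e1 : ic Kη = (2⁻¹ : ℂ) • (-ι Lη) := by
      rw [← map_neg]
      exact map_smul ι _ _
    have e2 : TB Kω = (2⁻¹ : ℂ) • ΦB.adjoint Lω := map_smul _ _ _
    simp only [zero_smul, exp_zero, one_mul, mul_one, hT, hT', hi, e1, e2]
    rw [← smul_add, show -ι Lη + Lσ = Lσ - ι Lη by abel,
      show TA ((2⁻¹ : ℂ) • (Lσ - ι Lη)) = (2⁻¹ : ℂ) • ΦA.adjoint (Lσ - ι Lη) from map_smul _ _ _,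
      ← mul_add, ← mul_add, ← smul_add, ← smul_add, mul_smul_comm, map_smul]
    simp [τc]
  rw [hval, Complex.re_ofReal_mul] at key
  linarith

end Interpolation

/-! ### Regularized logarithms -/

section Perturbation

variable {N : Type*} [CStarAlgebra N] [PartialOrder N] [StarOrderedRing N]

theorem isStrictlyPositive_add_algebraMap {x : N} (hx : 0 ≤ x) {ε : ℝ} (hε : 0 < ε) :
    IsStrictlyPositive (x + algebraMap ℝ N ε) := by
  have : IsStrictlyPositive (algebraMap ℝ N ε) := isStrictlyPositive_algebraMap hε
  rw [add_comm]
  exact this.add_nonneg hx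

theorem add_pos_of_mem_spectrum {x : N} (hx : 0 ≤ x) {ε : ℝ} (hε : 0 < ε) {t : ℝ}
    (ht : t ∈ spectrum ℝ x) : 0 < t + ε :=
  add_pos_of_nonneg_of_pos (spectrum_nonneg_of_nonneg hx ht) hε

theorem continuousOn_log_add {x : N} (hx : 0 ≤ x) {ε : ℝ} (hε : 0 < ε) :
    ContinuousOn (fun t : ℝ => Real.log (t + ε)) (spectrum ℝ x) :=
  (continuousOn_id.add continuousOn_const).log fun _ ht => (add_pos_of_mem_spectrum hx hε ht).ne'

theorem log_add_algebraMap {x : N} (hx : 0 ≤ x) {ε : ℝ} (hε : 0 < ε) :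
    CFC.log (x + algebraMap ℝ N ε) = cfc (fun t : ℝ => Real.log (t + ε)) x := by
  have hsa := hx.isSelfAdjoint
  have h1 : x + algebraMap ℝ N ε = cfc (fun t : ℝ => t + ε) x := by
    rw [cfc_add_const ε (fun t : ℝ => t) x, cfc_id' ℝ x]
  have h2 : ContinuousOn Real.log ((fun t : ℝ => t + ε) '' spectrum ℝ x) := by
    rintro _ ⟨t, ht, rfl⟩
    exact (Real.continuousAt_log (add_pos_of_mem_spectrum hx hε ht).ne').continuousWithinAt
  rw [CFC.log, h1, ← cfc_comp' Real.log (fun t : ℝ => t + ε) x h2]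

theorem mul_log_add_algebraMap {x : N} (hx : 0 ≤ x) {ε : ℝ} (hε : 0 < ε) :
    x * CFC.log (x + algebraMap ℝ N ε) = cfc (fun t : ℝ => t * Real.log (t + ε)) x := by
  have hsa := hx.isSelfAdjoint
  rw [log_add_algebraMap hx hε, cfc_mul (fun t : ℝ => t) _ x continuousOn_id
    (continuousOn_log_add hx hε), cfc_id' ℝ x]

theorem cfc_mul_log_le {x : N} (hx : 0 ≤ x) {ε : ℝ} (hε : 0 < ε) :
    cfc (fun t : ℝ => t * Real.log t) x ≤ x * CFC.log (x + algebraMap ℝ N ε) := by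
  rw [mul_log_add_algebraMap hx hε]
  refine cfc_mono (fun t ht => ?_) Real.continuous_mul_log.continuousOn
    (continuousOn_id.mul (continuousOn_log_add hx hε))
  have ht0 := spectrum_nonneg_of_nonneg hx ht
  rcases ht0.eq_or_lt with rfl | h
  · simp
  · exact mul_le_mul_of_nonneg_left (Real.log_le_log h (by linarith)) ht0

/-- For `t > 0`, `log(1 + ε/t) ≤ ε/t` bounds the error by `ε` uniformly in `t`; at `t = 0` both
logarithmic terms vanish. -/
theorem mul_log_le_cfc {x : N} (hx : 0 ≤ x) {ε : ℝ} (hε : 0 < ε) :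
    x * CFC.log (x + algebraMap ℝ N ε) ≤
      cfc (fun t : ℝ => t * Real.log t) x + algebraMap ℝ N ε := by
  have hsa := hx.isSelfAdjoint
  rw [mul_log_add_algebraMap hx hε,
    ← cfc_add_const ε (fun t : ℝ => t * Real.log t) x Real.continuous_mul_log.continuousOn]
  refine cfc_mono (fun t ht => ?_) (continuousOn_id.mul (continuousOn_log_add hx hε))
    (Real.continuous_mul_log.add continuous_const).continuousOn
  have ht0 := spectrum_nonneg_of_nonneg hx ht
  rcases ht0.eq_or_lt with rfl | h
  · simpa using hε.le
  · have h1 : Real.log (t + ε) ≤ Real.log t + ε / t := by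
      have h2 : t + ε = t * (1 + ε / t) := by field_simp
      have h3 : 0 < ε / t := div_pos hε h
      rw [h2, Real.log_mul h.ne' (by positivity)]
      linarith [Real.log_le_sub_one_of_pos (show 0 < 1 + ε / t by positivity)]
    calc t * Real.log (t + ε) ≤ t * (Real.log t + ε / t) := by gcongr
      _ = t * Real.log t + ε := by field_simp

/-- This is `t²/(t + ε) ≤ t` on the spectrum. It supplies the bound on `ρ` needed on the right line,
even for singular `ρ`. -/
theorem mul_exp_neg_log_mul_le {x : N} (hx : 0 ≤ x) {ε : ℝ} (hε : 0 < ε) :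
    x * NormedSpace.exp (-CFC.log (x + algebraMap ℝ N ε)) * x ≤ x := by
  have hsa := hx.isSelfAdjoint
  have hc := continuousOn_log_add hx hε
  have h1 : NormedSpace.exp (-CFC.log (x + algebraMap ℝ N ε)) =
      cfc (fun t : ℝ => Real.exp (-Real.log (t + ε))) x := by
    rw [log_add_algebraMap hx hε, ← cfc_neg, ← CFC.real_exp_eq_normedSpace_exp (cfc_predicate _ x),
      ← cfc_comp' Real.exp (fun t : ℝ => -Real.log (t + ε)) x
        Real.continuous_exp.continuousOn hc.neg]
  have hc2 : ContinuousOn (fun t : ℝ => Real.exp (-Real.log (t + ε))) (spectrum ℝ x) :=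
    hc.neg.rexp
  have h2 : x * cfc (fun t : ℝ => Real.exp (-Real.log (t + ε))) x * x =
      cfc (fun t : ℝ => t * Real.exp (-Real.log (t + ε)) * t) x := by
    rw [cfc_mul (fun t : ℝ => t * Real.exp (-Real.log (t + ε))) (fun t : ℝ => t) x
      (continuousOn_id.mul hc2) continuousOn_id,
      cfc_mul (fun t : ℝ => t) _ x continuousOn_id hc2, cfc_id' ℝ x]
  rw [h1, h2]
  conv_rhs => rw [← cfc_id' ℝ x]
  refine cfc_mono (fun t ht => ?_) ((continuousOn_id.mul hc2).mul continuousOn_id) continuousOn_id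
  have hpos := add_pos_of_mem_spectrum hx hε ht
  have ht0 := spectrum_nonneg_of_nonneg hx ht
  rw [Real.exp_neg, Real.exp_log hpos]
  refine mul_le_of_le_one_left ht0 ?_
  rw [← div_eq_mul_inv, div_le_one hpos]
  linarith

theorem FaithfulTrace.re_algebraMap (τ : FaithfulTrace N) (r : ℝ) :
    (τ (algebraMap ℝ N r)).re = r * (τ 1).re := by
  rw [Algebra.algebraMap_eq_smul_one, ← Complex.coe_smul, map_smul, smul_eq_mul,
    Complex.re_ofReal_mul]

theorem neg_entropy_le (τ : FaithfulTrace N) {x : N} (hx : 0 ≤ x) {ε : ℝ} (hε : 0 < ε) :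
    -entropy τ x ≤ (τ (x * CFC.log (x + algebraMap ℝ N ε))).re := by
  rw [entropy, neg_neg]
  exact τ.re_mono (cfc_mul_log_le hx hε)

theorem re_trace_mul_log_le (τ : FaithfulTrace N) {x : N} (hx : 0 ≤ x) {ε : ℝ} (hε : 0 < ε) :
    (τ (x * CFC.log (x + algebraMap ℝ N ε))).re ≤ -entropy τ x + ε * (τ 1).re := by
  have := τ.re_mono (mul_log_le_cfc hx hε)
  rw [map_add, Complex.add_re, τ.re_algebraMap] at this
  rwa [entropy, neg_neg]

end Perturbation

/-! ### The entropy inequality -/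

section Main

variable {A B M R : Type*}
  [CStarAlgebra A] [PartialOrder A] [StarOrderedRing A] [FiniteDimensional ℂ A]
  [CStarAlgebra B] [PartialOrder B] [StarOrderedRing B] [FiniteDimensional ℂ B]
  [CStarAlgebra M] [PartialOrder M] [StarOrderedRing M] [FiniteDimensional ℂ M]
  [CStarAlgebra R] [PartialOrder R] [StarOrderedRing R] [FiniteDimensional ℂ R]
  {τA : FaithfulTrace A} {τB : FaithfulTrace B} {τM : FaithfulTrace M} {τR : FaithfulTrace R}
  {ι : R →⋆ₐ[ℂ] A} (ΦA : QuantumChannel τM τA) (ΦB : QuantumChannel τM τB)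

/-- The entropy inequality up to an error linear in the regularization parameter. -/
theorem entropy_le_add_error [Nontrivial M] (hι : Function.Injective ι) {ρ : M}
    (hρ : IsDensity τM ρ) {ε : ℝ} (hε : 0 < ε) :
    entropy τM ρ + entropy τR (embeddingAdjoint τR τA ι (ΦA ρ)) ≤
      entropy τA (ΦA ρ) + entropy τB (ΦB ρ) + Real.log (overlapConst τR ι ΦA ΦB) +
        ε * ((τM 1).re + (τB 1).re + (‖embeddingAdjoint τR τA ι 1‖ + 1) * (τR 1).re) := by
  set d := embeddingAdjoint τR τA ι 1 with hd
  set σ := ΦA ρ with hσ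
  set ω := ΦB ρ with hω
  set η := embeddingAdjoint τR τA ι σ with hη
  have hσ0 : 0 ≤ σ := ΦA.map_nonneg hρ.1
  have hω0 : 0 ≤ ω := ΦB.map_nonneg hρ.1
  have hη0 : 0 ≤ η := embeddingAdjoint_nonneg hσ0
  have hd0 : IsStrictlyPositive d := isStrictlyPositive_embeddingAdjoint_one hι
  -- The interpolation needs the regularized `η` to be the image of `σ + ε`, so the shift is `ε d`,
  -- not `ε`.
  set ηε : R := η + (ε : ℂ) • d with hηε
  -- A scalar shift dominating `ε d`; the `+ 1` ensures `δ > 0` in every case.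
  set δ : ℝ := ε * (‖d‖ + 1) with hδdef
  have hδ : 0 < δ := by positivity
  have hηεpos : IsStrictlyPositive ηε := by
    rw [hηε, add_comm, Complex.coe_smul]
    exact (hd0.smul hε).add_nonneg hη0
  have hηεle : ηε ≤ η + algebraMap ℝ R δ := by
    rw [hηε, hδdef, map_mul, Complex.coe_smul, ← Algebra.smul_def]
    refine add_le_add_right (smul_le_smul_of_nonneg_left ?_ hε.le) η
    refine (IsSelfAdjoint.le_algebraMap_norm_self hd0.isSelfAdjoint).trans ?_
    exact algebraMap_mono R (by linarith)
  have hB1 : 0 ≤ (τB 1).re := (Complex.nonneg_iff.1 (τB.nonneg zero_le_one)).1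
  have hω1 : (τB (ω + algebraMap ℝ B ε)).re = 1 + ε * (τB 1).re := by
    rw [map_add, Complex.add_re, τB.re_algebraMap, hω, ΦB.trace_map, hρ.2, Complex.one_re]
  have hexpω := CFC.exp_log _ (isStrictlyPositive_add_algebraMap hω0 hε)
  have hexpσ := CFC.exp_log _ (isStrictlyPositive_add_algebraMap hσ0 hε)
  have hexpη := CFC.exp_log _ hηεpos
  have hc := overlapConst_pos (τR := τR) ΦA ΦB hι
  have key := re_trace_mul_logs_le (τR := τR) (Lρ := CFC.log (ρ + algebraMap ℝ M ε))
    (Lω := CFC.log (ω + algebraMap ℝ B ε)) (Lσ := CFC.log (σ + algebraMap ℝ A ε))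
    (Lη := CFC.log ηε) ΦA ΦB hι hρ IsSelfAdjoint.log IsSelfAdjoint.log IsSelfAdjoint.log
    IsSelfAdjoint.log
    ((τM.re_mono (mul_exp_neg_log_mul_le hρ.1 hε)).trans_eq (by rw [hρ.2, Complex.one_re]))
    (by rw [hexpω, hω1]; positivity)
    (by
      rw [hexpσ, hexpη, Algebra.algebraMap_eq_smul_one, ← Complex.coe_smul, map_add, map_smul])
  rw [hexpω, hω1, Real.log_mul hc.ne' (by positivity)] at key
  have hlog : Real.log (1 + ε * (τB 1).re) ≤ ε * (τB 1).re := by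
    linarith [Real.log_le_sub_one_of_pos (show 0 < 1 + ε * (τB 1).re by positivity)]
  have e1 : τM (ρ * ΦB.adjoint (CFC.log (ω + algebraMap ℝ B ε))) =
      τB (ω * CFC.log (ω + algebraMap ℝ B ε)) := by
    rw [τM.mul_comm, ΦB.adjoint_spec, τB.mul_comm]
  have e2 : τM (ρ * ΦA.adjoint (CFC.log (σ + algebraMap ℝ A ε) - ι (CFC.log ηε))) =
      τA (σ * CFC.log (σ + algebraMap ℝ A ε)) - τR (η * CFC.log ηε) := by
    rw [τM.mul_comm, ΦA.adjoint_spec, τA.mul_comm, mul_sub, map_sub, hη, embeddingAdjoint_spec]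
  rw [mul_add, mul_add, map_add, map_add, e1, e2, mul_neg, map_neg] at key
  simp only [Complex.add_re, Complex.sub_re, Complex.neg_re] at key
  have b1 := re_trace_mul_log_le τM hρ.1 hε
  have b2 := neg_entropy_le τB hω0 hε
  have b3 := neg_entropy_le τA hσ0 hε
  have b4 := re_trace_mul_log_le τR hη0 hδ
  -- Operator monotonicity of the logarithm trades the shift `ε d` for the scalar `δ`, to which the
  -- entropy estimate applies.
  have b5 : (τR (η * CFC.log ηε)).re ≤ (τR (η * CFC.log (η + algebraMap ℝ R δ))).re := by
    have := (Complex.nonneg_iff.1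
      (τR.mul_nonneg hη0 (sub_nonneg.2 (CFC.log_le_log hηεle hηεpos)))).1
    rw [mul_sub, map_sub, Complex.sub_re] at this
    linarith
  rw [hδdef] at b4
  linarith

end Main

end ChannelSSA

end

theorem theorem3p1 {A B M R : Type*}
    [CStarAlgebra A] [PartialOrder A] [StarOrderedRing A] [FiniteDimensional ℂ A]
    [CStarAlgebra B] [PartialOrder B] [StarOrderedRing B] [FiniteDimensional ℂ B]
    [CStarAlgebra M] [PartialOrder M] [StarOrderedRing M] [FiniteDimensional ℂ M]
    [CStarAlgebra R] [PartialOrder R] [StarOrderedRing R] [FiniteDimensional ℂ R]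
    (τA : ChannelSSA.FaithfulTrace A) (τB : ChannelSSA.FaithfulTrace B)
    (τM : ChannelSSA.FaithfulTrace M) (τR : ChannelSSA.FaithfulTrace R)
    (ι : R →⋆ₐ[ℂ] A) (hι : Function.Injective ι)
    (ΦA : ChannelSSA.QuantumChannel τM τA) (ΦB : ChannelSSA.QuantumChannel τM τB)
    (ρ : M) (hρ : ChannelSSA.IsDensity τM ρ) :
    IsLUB (ChannelSSA.overlapSet τR ι ΦA ΦB) (ChannelSSA.overlapConst τR ι ΦA ΦB) ∧
    0 < ChannelSSA.overlapConst τR ι ΦA ΦB ∧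
    ChannelSSA.entropy τA (ΦA ρ) + ChannelSSA.entropy τB (ΦB ρ) ≥
      ChannelSSA.entropy τM ρ +
        ChannelSSA.entropy τR (ChannelSSA.embeddingAdjoint τR τA ι (ΦA ρ)) +
        Real.log (1 / ChannelSSA.overlapConst τR ι ΦA ΦB) := by
  have hM : Nontrivial M := by
    by_contra h
    rw [not_nontrivial_iff_subsingleton] at h
    have h1 := hρ.2
    rw [Subsingleton.elim ρ 0, map_zero] at h1
    exact zero_ne_one h1
  refine ⟨ChannelSSA.isLUB_overlapConst ΦA ΦB hι, ChannelSSA.overlapConst_pos ΦA ΦB hι, ?_⟩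
  rw [one_div, Real.log_inv, ge_iff_le, ← sub_eq_add_neg, sub_le_iff_le_add]
  have hM1 : 0 ≤ (τM 1).re := (Complex.nonneg_iff.1 (τM.nonneg zero_le_one)).1
  have hB1 : 0 ≤ (τB 1).re := (Complex.nonneg_iff.1 (τB.nonneg zero_le_one)).1
  have hR1 : 0 ≤ (τR 1).re := (Complex.nonneg_iff.1 (τR.nonneg zero_le_one)).1
  set K := (τM 1).re + (τB 1).re +
    (‖ChannelSSA.embeddingAdjoint τR τA ι 1‖ + 1) * (τR 1).re with hK
  have hK0 : 0 ≤ K := by positivity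
  refine le_of_forall_pos_le_add fun t ht => ?_
  -- With this `ε` the error is `t K/(K + 1) ≤ t`; the `+ 1` avoids dividing by zero.
  have h := ChannelSSA.entropy_le_add_error (τR := τR) ΦA ΦB hι hρ (ε := t / (K + 1))
    (by positivity)
  refine h.trans (add_le_add_right ?_ _)
  rw [← hK, div_mul_eq_mul_div, div_le_iff₀ (by positivity)]
  nlinarith
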